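/- Let $\Sigma$ be a finite alphabet, let $1\notin\Sigma$ be a separator, and let the rank of a word over $\Sigma\cup\{1\}$ be its number of separators. For words $u,v$ over $\Sigma\cup\{1\}$ such that $u$ has at least $j\ge 1$ separators, $u\odot_j v$ denotes the result of replacing the $j$-th separator of $u$ by $v$. Let $k\ge 0$ and let $N$ be a finite set of nonterminals, disjoint from $\Sigma$, with ranks $\mathrm{rk}(A)\in\{0,\dots,k\}$. The $k$-correct terms and their ranks are defined inductively: every $A\in N$ is a term of rank $\mathrm{rk}(A)$; every word of $\Sigma^*$ is a term of rank $0$; $1$ is a term of rank $1$; if $\alpha,\beta$ are terms with $\mathrm{rk}(\alpha)+\mathrm{rk}(\beta)\le k$, then $\alpha\cdot\beta$ is a term of rank $\mathrm{rk}(\alpha)+\mathrm{rk}(\beta)$; if $1\le j\le k$ and $\alpha,\beta$ are terms with $\mathrm{rk}(\alpha)\ge j$ and $\mathrm{rk}(\alpha)+\mathrm{rk}(\beta)\le k+1$, then $\alpha\odot_j\beta$ is a term of rank $\mathrm{rk}(\alpha)+\mathrm{rk}(\beta)-1$. A term without nonterminals is called ground; its value is the word over $\Sigma\cup\{1\}$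 obtained by reading $\cdot$ as concatenation and $\odot_j$ as the operation above. A $k$-displacement context-free grammar ($k$-DCFG) over $\Sigma$ consists of such a set $N$, a start symbol $S\in N$ of rank $0$ and a finite set of rules $A\to\alpha$, where $A\in N$ and $\alpha$ is a $k$-correct term with $\mathrm{rk}(\alpha)=\mathrm{rk}(A)$. A derivation from $S$ starts with the term $S$ and at each step replaces one occurrence of a nonterminal $B$ by $\beta$, where $B\to\beta$ is a rule. The language generated by the grammar is the set of values of the ground terms derivable from $S$; it is a subset of $\Sigma^*$. **Theorem.** Let $a,b,c,d$ be four distinct letters of a finite alphabet $\Sigma$. The language $$4\mathrm{MIX}=\{w\in\{a,b,c,d\}^* : |w|_a=|w|_b=|w|_c=|w|_d\}$$ is not generated by any $1$-DCFG over $\Sigma$. -/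

import Mathlib

universe u v

namespace Displacement

/-- Words over `Σ₁ = Σ ∪ {1}`: `some a` is the letter `a ∈ Σ`, `none` is the separator `1 ∉ Σ`. -/
abbrev SepWord (T : Type u) : Type u := List (Option T)

/-- `j`-intercalation `u ⊙ⱼ v`: the `j`-th separator of `u` (counted from `1`) is replaced
by `v`. If `u` has no `j`-th separator (this never happens in a correct term), `u` is returned. -/
def intercalate {T : Type u} : ℕ → SepWord T → SepWord T → SepWord T
  | _, [], _ => []
  | j, some a :: u, v => some a :: intercalate j u v
  | j, none :: u, v => if j = 1 then v ++ u else none :: intercalate (j - 1) u v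

/-- Terms built from nonterminals, words of `Σ*` and the separator `1` by concatenation and
the intercalations `⊙ⱼ`. -/
inductive Term (N : Type v) (T : Type u) : Type (max u v)
  | nt (A : N) : Term N T
  | word (w : List T) : Term N T
  | sep : Term N T
  | concat (α β : Term N T) : Term N T
  | inter (j : ℕ) (α β : Term N T) : Term N T

namespace Term

variable {N : Type v} {T : Type u}

/-- The rank of a term, given the ranks of the nonterminals. -/
def rank (rk : N → ℕ) : Term N T → ℕ
  | nt A => rk A
  | word _ => 0
  | sep => 1
  | concat α β => α.rank rk + β.rank rk
  | inter _ α β => α.rank rk + β.rank rk - 1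

/-- Membership in the set `Tm_k(N, Σ)` of `k`-correct terms. -/
def IsCorrect (k : ℕ) (rk : N → ℕ) : Term N T → Prop
  | nt A => rk A ≤ k
  | word _ => True
  | sep => True
  | concat α β => α.IsCorrect k rk ∧ β.IsCorrect k rk ∧ α.rank rk + β.rank rk ≤ k
  | inter j α β => α.IsCorrect k rk ∧ β.IsCorrect k rk ∧ 1 ≤ j ∧ j ≤ k ∧
      α.rank rk + β.rank rk ≤ k + 1 ∧ j ≤ α.rank rk

/-- A term is ground if no nonterminal occurs in it. -/
def IsGround : Term N T → Prop
  | nt _ => False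
  | word _ => True
  | sep => True
  | concat α β => α.IsGround ∧ β.IsGround
  | inter _ α β => α.IsGround ∧ β.IsGround

/-- The value `ν(α)` of a ground term (the value at a nonterminal is irrelevant: `value` is
only used on ground terms). -/
def value : Term N T → SepWord T
  | nt _ => []
  | word w => w.map some
  | sep => [none]
  | concat α β => α.value ++ β.value
  | inter j α β => intercalate j α.value β.value

end Term

/-- Contexts `C[x]`: terms in which the variable `x` (`hole`) occupies exactly one leaf. -/
inductive Context (N : Type v) (T : Type u) : Type (max u v)
  | hole : Context N T
  | concatLeft (C : Context N T) (β : Term N T) : Context N T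
  | concatRight (α : Term N T) (C : Context N T) : Context N T
  | interLeft (j : ℕ) (C : Context N T) (β : Term N T) : Context N T
  | interRight (j : ℕ) (α : Term N T) (C : Context N T) : Context N T

/-- `C.fill γ` is `C[γ]`, the result of substituting the term `γ` for the variable in `C`. -/
def Context.fill {N : Type v} {T : Type u} : Context N T → Term N T → Term N T
  | hole, γ => γ
  | concatLeft C β, γ => Term.concat (C.fill γ) β
  | concatRight α C, γ => Term.concat α (C.fill γ)
  | interLeft j C β, γ => Term.inter j (C.fill γ) β
  | interRight j α C, γ => Term.inter j α (C.fill γ)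

/-- A `k`-displacement context-free grammar over the terminal alphabet `T`. Nonterminals and
terminals have different types, hence are disjoint. A pair `(A, α) ∈ rules` is the rule
`A → α`. -/
structure DCFG (k : ℕ) (T : Type u) where
  /-- the nonterminals -/
  NT : Type v
  /-- there are finitely many nonterminals -/
  finite_NT : Finite NT
  /-- the ranks of the nonterminals -/
  rk : NT → ℕ
  /-- ranks are in `{0, …, k}` -/
  rk_le : ∀ A, rk A ≤ k
  /-- the start symbol -/
  start : NT
  /-- the start symbol has rank `0` -/
  rk_start : rk start = 0
  /-- the rules, finite in number -/
  rules : Finset (NT × Term NT T)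
  /-- the right-hand sides are `k`-correct terms -/
  rules_correct : ∀ r ∈ rules, r.2.IsCorrect k rk
  /-- both sides of a rule have the same rank -/
  rules_rank : ∀ r ∈ rules, r.2.rank rk = rk r.1

namespace DCFG

variable {k : ℕ} {T : Type u}

/-- Derivability `A ⊢ α`: the smallest relation with `A ⊢ A` such that `A ⊢ C[B]` and
`(B → β) ∈ P` imply `A ⊢ C[β]`. -/
inductive Derives (G : DCFG.{u, v} k T) (A : G.NT) : Term G.NT T → Prop
  | refl : Derives G A (Term.nt A)
  | step (C : Context G.NT T) (B : G.NT) (β : Term G.NT T)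
      (h : Derives G A (C.fill (Term.nt B))) (hr : (B, β) ∈ G.rules) : Derives G A (C.fill β)

/-- `L_G(A)`: the values of the ground `k`-correct terms derivable from `A`. -/
def languageFrom (G : DCFG.{u, v} k T) (A : G.NT) : Set (SepWord T) :=
  {w | ∃ α : Term G.NT T, G.Derives A α ∧ α.IsCorrect k G.rk ∧ α.IsGround ∧ α.value = w}

/-- `L(G) = L_G(S)`, as a language over `T`: as `S` has rank `0`, the elements of `L_G(S)` are
words without separators. -/
def language (G : DCFG.{u, v} k T) : Language T :=
  {w : List T | w.map some ∈ G.languageFrom G.start}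

end DCFG

/-- The language `4MIX` of all words over `{a, b, c, d}` with equally many occurrences of
`a`, `b`, `c` and `d`. -/
def fourMIX {T : Type u} [DecidableEq T] (a b c d : T) : Language T :=
  {w : List T | (∀ x ∈ w, x = a ∨ x = b ∨ x = c ∨ x = d) ∧
    w.count a = w.count b ∧ w.count b = w.count c ∧ w.count c = w.count d}

end Displacement

/-!
The argument is a size-versus-balance count on derivation trees; no pumping is needed.

Suppose a `1`-DCFG generates `4MIX`. A node of the derivation tree of a word of the language is
labelled by one of finitely many terms: a nonterminal or a subterm of a right-hand side
(`DCFG.labels`). Replacing the subtree at that node by another one with the same label gives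
again a word of the language, and intercalation only permutes letters, so the differences between
the numbers of `a`, `b`, `c`, `d` in the yield of the node depend on the label only
(`DCFG.IsUseful.exists_balanced`). Hence the yields of all nodes are balanced up to a
constant `K`.

The tree branches in at most two, and the number of letters is additive, so for every
large `s` each long word has a node whose yield has between `s` and `2s` letters
(`DCFG.exists_intermediate_node`). As the ranks are at most `1`, this yield consists of at most two
separator-free factors of the word.

For the word `b²ᵐ aᵐ c²ᵐ aᵐ d²ᵐ` with `m ≥ 2s`, a factor of length at most `m` contains at
most one of the letters `b`, `c`, `d` (`not_mem_of_infix_blockWord`). So two such factors miss one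
of the letters, all letters then occur at most `K` times in the yield, and its size is at
most `4K`, which is impossible for `s > 4K`.
-/

namespace Displacement

variable {N : Type v} {T : Type u}

/-! ### Intercalation -/

theorem perm_intercalate {j : ℕ} {u : SepWord T} (v : SepWord T) (hj : 1 ≤ j)
    (hu : j ≤ u.countP Option.isNone) : (none :: intercalate j u v).Perm (u ++ v) := by
  induction u generalizing j with
  | nil => simp at hu; omega
  | cons x u ih =>
    cases x with
    | some x =>
      have h := ih hj (by simpa using hu)
      simp only [intercalate, List.cons_append]
      exact (List.Perm.swap _ _ _).trans (h.cons _)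
    | none =>
      simp only [intercalate, List.cons_append]
      split_ifs with h1
      · exact (List.perm_append_comm).cons _
      · refine (ih (j := j - 1) (by omega) ?_).cons _
        simp at hu
        omega

theorem countP_intercalate (p : Option T → Bool) (hp : p none = false) {j : ℕ} {u : SepWord T}
    (v : SepWord T) (hj : 1 ≤ j) (hu : j ≤ u.countP Option.isNone) :
    (intercalate j u v).countP p = u.countP p + v.countP p := by
  simpa [hp] using (perm_intercalate v hj hu).countP_eq p

theorem countP_isNone_intercalate {j : ℕ} {u : SepWord T} (v : SepWord T) (hj : 1 ≤ j)
    (hu : j ≤ u.countP Option.isNone) : (intercalate j u v).countP Option.isNone =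
      u.countP Option.isNone + v.countP Option.isNone - 1 := by
  have := (perm_intercalate v hj hu).countP_eq Option.isNone
  simp at this
  omega

theorem infix_intercalate_right {j : ℕ} {u : SepWord T} (v : SepWord T) (hj : 1 ≤ j)
    (hu : j ≤ u.countP Option.isNone) : v <:+: intercalate j u v := by
  induction u generalizing j with
  | nil => simp at hu; omega
  | cons x u ih =>
    cases x with
    | some x => exact (ih hj (by simpa using hu)).trans (List.suffix_cons _ _).isInfix
    | none =>
      simp only [intercalate]
      split_ifs with h1
      · exact (List.prefix_append _ _).isInfix
      · refine (ih (j := j - 1) (by omega) ?_).trans (List.suffix_cons _ _).isInfix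
        simp at hu
        omega

theorem prefix_intercalate_left {j : ℕ} {u v : SepWord T} {z : List T}
    (hz : z.map some <+: u) : z.map some <+: intercalate j u v := by
  induction u generalizing z with
  | nil => simpa [intercalate] using hz
  | cons x u ih =>
    cases z with
    | nil => simp
    | cons y z =>
      cases x with
      | none => simp at hz
      | some x =>
        simp only [List.map_cons, List.cons_prefix_cons, intercalate] at hz ⊢
        exact ⟨hz.1, ih hz.2⟩

/-- Intercalation only breaks its first argument at a separator. -/
theorem infix_intercalate_left {j : ℕ} {u v : SepWord T} {z : List T}
    (hz : z.map some <:+: u) : z.map some <:+: intercalate j u v := by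
  induction u generalizing j with
  | nil => simpa [intercalate] using hz
  | cons x u ih =>
    rcases List.infix_cons_iff.1 hz with h | h
    · exact (prefix_intercalate_left h).isInfix
    · cases x with
      | some x => exact (ih h).trans (List.suffix_cons _ _).isInfix
      | none =>
        simp only [intercalate]
        split_ifs with h1
        · exact h.trans (List.suffix_append _ _).isInfix
        · exact (ih h).trans (List.suffix_cons _ _).isInfix

theorem exists_eq_map_some {y : SepWord T} (hy : y.countP Option.isNone = 0) :
    ∃ z : List T, y = z.map some := by
  induction y with
  | nil => exact ⟨[], rfl⟩
  | cons x y ih =>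
    cases x with
    | none => simp at hy
    | some x =>
      obtain ⟨z, rfl⟩ := ih (by simpa using hy)
      exact ⟨x :: z, rfl⟩

theorem countP_isSome_map_some (z : List T) : (z.map some).countP Option.isSome = z.length := by
  rw [List.countP_map, List.countP_eq_length]
  simp

/-- A word of rank at most one consists of at most two separator-free factors. -/
theorem exists_two_factors {y : SepWord T} (hy : y.countP Option.isNone ≤ 1) :
    ∃ z₁ z₂ : List T, z₁.map some <:+: y ∧ z₂.map some <:+: y ∧
      ∀ x, some x ∈ y → x ∈ z₁ ∨ x ∈ z₂ := by
  by_cases h : none ∈ y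
  · obtain ⟨p, q, rfl⟩ := List.append_of_mem h
    rw [List.countP_append, List.countP_cons_of_pos rfl] at hy
    obtain ⟨z₁, rfl⟩ := exists_eq_map_some (y := p) (by omega)
    obtain ⟨z₂, rfl⟩ := exists_eq_map_some (y := q) (by omega)
    exact ⟨z₁, z₂, (List.prefix_append _ _).isInfix,
      ((List.suffix_cons _ _).trans (List.suffix_append _ _)).isInfix, by simp⟩
  · obtain ⟨z, rfl⟩ := exists_eq_map_some (y := y) (by
      rw [List.countP_eq_zero]
      rintro (_ | x) hx
      · exact (h hx).elim
      · simp)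
    exact ⟨z, [], List.infix_rfl, by simp, by simp⟩

/-! ### Terms -/

namespace Term

/-- The subterms of a term, including the term itself. -/
def subterms : Term N T → Set (Term N T)
  | nt A => {nt A}
  | word w => {word w}
  | sep => {sep}
  | concat α β => {concat α β} ∪ (α.subterms ∪ β.subterms)
  | inter j α β => {inter j α β} ∪ (α.subterms ∪ β.subterms)

theorem self_mem_subterms (τ : Term N T) : τ ∈ τ.subterms := by
  cases τ <;> simp [subterms]

theorem finite_subterms (τ : Term N T) : τ.subterms.Finite := by
  induction τ with
  | nt A => exact Set.finite_singleton _
  | word w => exact Set.finite_singleton _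
  | sep => exact Set.finite_singleton _
  | concat α β hα hβ => exact (Set.finite_singleton _).union (hα.union hβ)
  | inter j α β hα hβ => exact (Set.finite_singleton _).union (hα.union hβ)

theorem IsCorrect.rank_le {k : ℕ} (hk : 1 ≤ k) {rk : N → ℕ} {τ : Term N T}
    (h : τ.IsCorrect k rk) : τ.rank rk ≤ k := by
  cases τ <;> simp only [IsCorrect, rank] at h ⊢ <;> omega

end Term

namespace DCFG

variable {k : ℕ} {G : DCFG.{u, v} k T}

/-! ### Derivation trees -/

/-- `G.Expands τ γ`: there are derivation trees of `G` for the nonterminals of `τ` that turn `τ`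
into the ground term `γ`. -/
inductive Expands (G : DCFG.{u, v} k T) : Term G.NT T → Term G.NT T → Prop
  | nt {A : G.NT} {α γ : Term G.NT T} (hr : (A, α) ∈ G.rules) (h : Expands G α γ) :
      Expands G (Term.nt A) γ
  | word (w : List T) : Expands G (Term.word w) (Term.word w)
  | sep : Expands G Term.sep Term.sep
  | concat {α β γ₁ γ₂ : Term G.NT T} (h₁ : Expands G α γ₁) (h₂ : Expands G β γ₂) :
      Expands G (Term.concat α β) (Term.concat γ₁ γ₂)
  | inter {α β γ₁ γ₂ : Term G.NT T} (j : ℕ) (h₁ : Expands G α γ₁) (h₂ : Expands G β γ₂) :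
      Expands G (Term.inter j α β) (Term.inter j γ₁ γ₂)

theorem expands_self {γ : Term G.NT T} (h : γ.IsGround) : G.Expands γ γ := by
  induction γ with
  | nt A => exact h.elim
  | word w => exact .word w
  | sep => exact .sep
  | concat α β hα hβ => exact .concat (hα h.1) (hβ h.2)
  | inter j α β hα hβ => exact .inter j (hα h.1) (hβ h.2)

theorem Expands.isGround {τ γ : Term G.NT T} (h : G.Expands τ γ) : γ.IsGround := by
  induction h with
  | nt _ _ ih => exact ih
  | word => trivial
  | sep => trivial
  | concat _ _ h₁ h₂ => exact ⟨h₁, h₂⟩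
  | inter _ _ _ h₁ h₂ => exact ⟨h₁, h₂⟩

theorem Expands.correct {τ γ : Term G.NT T} (h : G.Expands τ γ) (hτ : τ.IsCorrect k G.rk) :
    γ.IsCorrect k G.rk ∧ γ.rank G.rk = τ.rank G.rk := by
  induction h with
  | nt hr _ ih =>
    obtain ⟨h₁, h₂⟩ := ih (G.rules_correct _ hr)
    exact ⟨h₁, h₂.trans (G.rules_rank _ hr)⟩
  | word => exact ⟨trivial, rfl⟩
  | sep => exact ⟨trivial, rfl⟩
  | concat _ _ h₁ h₂ =>
    obtain ⟨c₁, r₁⟩ := h₁ hτ.1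
    obtain ⟨c₂, r₂⟩ := h₂ hτ.2.1
    simp only [Term.IsCorrect, Term.rank, r₁, r₂]
    exact ⟨⟨c₁, c₂, hτ.2.2⟩, trivial⟩
  | inter _ _ _ h₁ h₂ =>
    obtain ⟨c₁, r₁⟩ := h₁ hτ.1
    obtain ⟨c₂, r₂⟩ := h₂ hτ.2.1
    simp only [Term.IsCorrect, Term.rank, r₁, r₂]
    exact ⟨⟨c₁, c₂, hτ.2.2⟩, trivial⟩

theorem Expands.countP_isNone_value {τ γ : Term G.NT T} (h : G.Expands τ γ)
    (hτ : τ.IsCorrect k G.rk) : γ.value.countP Option.isNone = τ.rank G.rk := by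
  induction h with
  | nt hr _ ih => exact (ih (G.rules_correct _ hr)).trans (G.rules_rank _ hr)
  | word => simp [Term.value, Term.rank]
  | sep => simp [Term.value, Term.rank]
  | concat _ _ h₁ h₂ =>
    simp only [Term.value, Term.rank, List.countP_append, h₁ hτ.1, h₂ hτ.2.1]
  | inter _ _ _ h₁ h₂ =>
    obtain ⟨c₁, c₂, hj, -, -, hj'⟩ := hτ
    rw [Term.value, countP_isNone_intercalate _ hj (by rw [h₁ c₁]; exact hj'), h₁ c₁, h₂ c₂,
      Term.rank]

theorem Expands.fill_nt {B : G.NT} {β : Term G.NT T} (hr : (B, β) ∈ G.rules)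
    (C : Context G.NT T) {γ : Term G.NT T} (h : G.Expands (C.fill β) γ) :
    G.Expands (C.fill (Term.nt B)) γ := by
  induction C generalizing γ with
  | hole => exact .nt hr h
  | concatLeft C δ ih => cases h with | concat h₁ h₂ => exact .concat (ih h₁) h₂
  | concatRight δ C ih => cases h with | concat h₁ h₂ => exact .concat h₁ (ih h₂)
  | interLeft j C δ ih => cases h with | inter _ h₁ h₂ => exact .inter j (ih h₁) h₂
  | interRight j δ C ih => cases h with | inter _ h₁ h₂ => exact .inter j h₁ (ih h₂)

theorem Derives.expands {A : G.NT} {τ γ : Term G.NT T} (h : G.Derives A τ)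
    (hγ : G.Expands τ γ) : G.Expands (Term.nt A) γ := by
  induction h with
  | refl => exact hγ
  | step C B β _ hr ih => exact ih (hγ.fill_nt hr C)

/-- The composition of contexts, with `(C.comp D).fill τ = C.fill (D.fill τ)`. -/
def _root_.Displacement.Context.comp : Context N T → Context N T → Context N T
  | .hole, D => D
  | .concatLeft C β, D => .concatLeft (C.comp D) β
  | .concatRight α C, D => .concatRight α (C.comp D)
  | .interLeft j C β, D => .interLeft j (C.comp D) β
  | .interRight j α C, D => .interRight j α (C.comp D)

theorem _root_.Displacement.Context.fill_comp (C D : Context N T) (τ : Term N T) :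
    (C.comp D).fill τ = C.fill (D.fill τ) := by
  induction C <;> simp_all [Context.comp, Context.fill]

theorem Expands.derives {τ γ : Term G.NT T} (hγ : G.Expands τ γ) {A : G.NT}
    {C : Context G.NT T} (h : G.Derives A (C.fill τ)) : G.Derives A (C.fill γ) := by
  induction hγ generalizing C with
  | nt hr _ ih => exact ih (.step C _ _ h hr)
  | word => exact h
  | sep => exact h
  | @concat α β γ₁ γ₂ _ _ ih₁ ih₂ =>
    have h' := ih₁ (C := C.comp (.concatLeft .hole β)) (by rw [Context.fill_comp]; exact h)
    rw [Context.fill_comp] at h'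
    have h'' := ih₂ (C := C.comp (.concatRight γ₁ .hole)) (by rw [Context.fill_comp]; exact h')
    rwa [Context.fill_comp] at h''
  | @inter α β γ₁ γ₂ j _ _ ih₁ ih₂ =>
    have h' := ih₁ (C := C.comp (.interLeft j .hole β)) (by rw [Context.fill_comp]; exact h)
    rw [Context.fill_comp] at h'
    have h'' := ih₂ (C := C.comp (.interRight j γ₁ .hole)) (by rw [Context.fill_comp]; exact h')
    rwa [Context.fill_comp] at h''

theorem mem_language_iff {w : List T} :
    w ∈ G.language ↔ ∃ γ, G.Expands (Term.nt G.start) γ ∧ γ.value = w.map some := by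
  constructor
  · rintro ⟨γ, h, -, hg, hv⟩
    exact ⟨γ, h.expands (expands_self hg), hv⟩
  · rintro ⟨γ, h, hv⟩
    exact ⟨γ, h.derives (C := .hole) .refl, (h.correct (G.rk_le _)).1, h.isGround, hv⟩

theorem Expands.exists_mem_language {γ : Term G.NT T} (h : G.Expands (Term.nt G.start) γ) :
    ∃ w ∈ G.language, γ.value = w.map some := by
  obtain ⟨w, hw⟩ := exists_eq_map_some
    ((h.countP_isNone_value (G.rk_le _)).trans G.rk_start)
  exact ⟨w, mem_language_iff.2 ⟨γ, h, hw⟩, hw⟩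

/-! ### Balance of the nodes of a derivation tree -/

/-- The labels of the nodes of derivation trees: nonterminals and subterms of right-hand sides. -/
def labels (G : DCFG.{u, v} k T) : Set (Term G.NT T) :=
  Set.range Term.nt ∪ ⋃ r ∈ G.rules, r.2.subterms

theorem finite_labels : G.labels.Finite := by
  have := G.finite_NT
  exact (Set.finite_range _).union
    (G.rules.finite_toSet.biUnion fun r _ => r.2.finite_subterms)

theorem subterms_subset_labels {A : G.NT} {α : Term G.NT T} (hr : (A, α) ∈ G.rules) :
    α.subterms ⊆ G.labels := fun _ h => Or.inr (Set.mem_biUnion hr h)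

theorem Expands.countP_value_inter {j : ℕ} {α β γ₁ : Term G.NT T} (γ₂ : Term G.NT T)
    (hτ : (Term.inter j α β).IsCorrect k G.rk) (h₁ : G.Expands α γ₁)
    {p : Option T → Bool} (hp : p none = false) :
    (Term.inter j γ₁ γ₂).value.countP p = γ₁.value.countP p + γ₂.value.countP p :=
  countP_intercalate p hp _ hτ.2.2.1 (by rw [h₁.countP_isNone_value hτ.1]; exact hτ.2.2.2.2.2)

variable [DecidableEq T]

/-- A label is useful if every tree with this root label is part of a derivation tree of the
start symbol. The rest of that tree is recorded by the numbers `δ x` of its letters only. -/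
def IsUseful (G : DCFG.{u, v} k T) (τ : Term G.NT T) : Prop :=
  ∃ δ : T → ℕ, ∀ γ, G.Expands τ γ → ∃ γ', G.Expands (Term.nt G.start) γ' ∧
    ∀ x, γ'.value.count (some x) = δ x + γ.value.count (some x)

theorem isUseful_start : G.IsUseful (Term.nt G.start) := ⟨0, fun γ h => ⟨γ, h, by simp⟩⟩

theorem IsUseful.of_rule {A : G.NT} {α : Term G.NT T} (hr : (A, α) ∈ G.rules)
    (h : G.IsUseful (Term.nt A)) : G.IsUseful α := by
  obtain ⟨δ, h⟩ := h
  exact ⟨δ, fun γ hγ => h γ (.nt hr hγ)⟩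

theorem IsUseful.concat_left {α β γ₂ : Term G.NT T} (h : G.IsUseful (Term.concat α β))
    (h₂ : G.Expands β γ₂) : G.IsUseful α := by
  obtain ⟨δ, h⟩ := h
  refine ⟨fun x => δ x + γ₂.value.count (some x), fun γ hγ => ?_⟩
  obtain ⟨γ', hγ', e⟩ := h _ (.concat hγ h₂)
  refine ⟨γ', hγ', fun x => ?_⟩
  rw [e, Term.value, List.count_append]
  ring

theorem IsUseful.concat_right {α β γ₁ : Term G.NT T} (h : G.IsUseful (Term.concat α β))
    (h₁ : G.Expands α γ₁) : G.IsUseful β := by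
  obtain ⟨δ, h⟩ := h
  refine ⟨fun x => δ x + γ₁.value.count (some x), fun γ hγ => ?_⟩
  obtain ⟨γ', hγ', e⟩ := h _ (.concat h₁ hγ)
  refine ⟨γ', hγ', fun x => ?_⟩
  rw [e, Term.value, List.count_append]
  ring

theorem IsUseful.inter_left {j : ℕ} {α β γ₂ : Term G.NT T} (h : G.IsUseful (Term.inter j α β))
    (hτ : (Term.inter j α β).IsCorrect k G.rk) (h₂ : G.Expands β γ₂) : G.IsUseful α := by
  obtain ⟨δ, h⟩ := h
  refine ⟨fun x => δ x + γ₂.value.count (some x), fun γ hγ => ?_⟩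
  obtain ⟨γ', hγ', e⟩ := h _ (.inter j hγ h₂)
  refine ⟨γ', hγ', fun x => ?_⟩
  have : (Term.inter j γ γ₂).value.count (some x) =
      γ.value.count (some x) + γ₂.value.count (some x) := hγ.countP_value_inter γ₂ hτ rfl
  rw [e, this]
  ring

theorem IsUseful.inter_right {j : ℕ} {α β γ₁ : Term G.NT T} (h : G.IsUseful (Term.inter j α β))
    (hτ : (Term.inter j α β).IsCorrect k G.rk) (h₁ : G.Expands α γ₁) : G.IsUseful β := by
  obtain ⟨δ, h⟩ := h
  refine ⟨fun x => δ x + γ₁.value.count (some x), fun γ hγ => ?_⟩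
  obtain ⟨γ', hγ', e⟩ := h _ (.inter j h₁ hγ)
  refine ⟨γ', hγ', fun x => ?_⟩
  have : (Term.inter j γ₁ γ).value.count (some x) =
      γ₁.value.count (some x) + γ.value.count (some x) := h₁.countP_value_inter γ hτ rfl
  rw [e, this]
  ring

/-- In a grammar for `4MIX`, the yields of a useful label contain no letters other than `a`, `b`,
`c`, `d`, and these up to a bounded difference equally often. -/
theorem IsUseful.exists_balanced {a b c d : T} (hG : G.language = fourMIX a b c d)
    {τ : Term G.NT T} (h : G.IsUseful τ) :
    ∃ K, ∀ γ, G.Expands τ γ →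
      (∀ x, some x ∈ γ.value → x ∈ [a, b, c, d]) ∧
      ∀ x ∈ [a, b, c, d], ∀ y ∈ [a, b, c, d],
        γ.value.count (some x) ≤ γ.value.count (some y) + K := by
  obtain ⟨δ, h⟩ := h
  refine ⟨δ a + δ b + δ c + δ d, fun γ hγ => ?_⟩
  obtain ⟨γ', hγ', e⟩ := h γ hγ
  obtain ⟨w, hw, hv⟩ := hγ'.exists_mem_language
  rw [hG] at hw
  obtain ⟨hmem, hab, hbc, hcd⟩ := hw
  have e' : ∀ x, w.count x = δ x + γ.value.count (some x) := fun x => by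
    rw [← e, hv, List.count_map_of_injective _ _ (Option.some_injective _)]
  constructor
  · intro x hx
    have : 0 < w.count x := by
      rw [e']
      exact Nat.add_pos_right _ (List.count_pos_iff.2 hx)
    simpa using hmem x (List.count_pos_iff.1 this)
  · rw [e', e'] at hab hbc hcd
    intro x hx y hy
    simp only [List.mem_cons, List.not_mem_nil, or_false] at hx hy
    rcases hx with rfl | rfl | rfl | rfl <;> rcases hy with rfl | rfl | rfl | rfl <;> omega

/-! ### Nodes of intermediate size -/

/-- If the yield of a useful tree has at least `s` letters, where `s` exceeds the lengths of all
words in the rules, then some node of the tree has a yield with at least `s` and less than `2s`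
letters. Its separator-free factors are factors of the whole yield. -/
theorem exists_intermediate_node {s : ℕ} (hs₀ : 0 < s)
    (hs : ∀ w, Term.word w ∈ G.labels → w.length < s)
    {τ γ : Term G.NT T} (h : G.Expands τ γ) (hτ : τ.IsCorrect k G.rk)
    (hl : τ.subterms ⊆ G.labels) (hu : G.IsUseful τ)
    (hγ : s ≤ γ.value.countP Option.isSome) :
    ∃ τ' γ', G.Expands τ' γ' ∧ τ'.IsCorrect k G.rk ∧ τ' ∈ G.labels ∧ G.IsUseful τ' ∧
      s ≤ γ'.value.countP Option.isSome ∧ γ'.value.countP Option.isSome < 2 * s ∧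
      ∀ z : List T, z.map some <:+: γ'.value → z.map some <:+: γ.value := by
  induction h with
  | nt hr _ ih =>
    exact ih (G.rules_correct _ hr) (subterms_subset_labels hr) (hu.of_rule hr) hγ
  | word w =>
    have := hs w (hl (Term.self_mem_subterms _))
    rw [Term.value, countP_isSome_map_some] at hγ
    omega
  | sep =>
    simp [Term.value] at hγ
    omega
  | @concat α β γ₁ γ₂ h₁ h₂ ih₁ ih₂ =>
    by_cases hlt : (Term.concat γ₁ γ₂).value.countP Option.isSome < 2 * s
    · exact ⟨_, _, .concat h₁ h₂, hτ, hl (Term.self_mem_subterms _), hu, hγ, hlt, fun _ h => h⟩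
    have hsum : (Term.concat γ₁ γ₂).value.countP Option.isSome =
        γ₁.value.countP Option.isSome + γ₂.value.countP Option.isSome := List.countP_append
    rcases le_total s (γ₁.value.countP Option.isSome) with hc | hc
    · obtain ⟨τ', γ', a₁, a₂, a₃, a₄, a₅, a₆, a₇⟩ := ih₁ hτ.1
        (fun _ h => hl (.inr (.inl h))) (hu.concat_left h₂) hc
      exact ⟨τ', γ', a₁, a₂, a₃, a₄, a₅, a₆,
        fun z hz => (a₇ z hz).trans (List.prefix_append _ _).isInfix⟩
    · obtain ⟨τ', γ', a₁, a₂, a₃, a₄, a₅, a₆, a₇⟩ := ih₂ hτ.2.1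
        (fun _ h => hl (.inr (.inr h))) (hu.concat_right h₁) (by omega)
      exact ⟨τ', γ', a₁, a₂, a₃, a₄, a₅, a₆,
        fun z hz => (a₇ z hz).trans (List.suffix_append _ _).isInfix⟩
  | @inter α β γ₁ γ₂ j h₁ h₂ ih₁ ih₂ =>
    by_cases hlt : (Term.inter j γ₁ γ₂).value.countP Option.isSome < 2 * s
    · exact ⟨_, _, .inter j h₁ h₂, hτ, hl (Term.self_mem_subterms _), hu, hγ, hlt, fun _ h => h⟩
    have hsum := h₁.countP_value_inter γ₂ hτ (p := Option.isSome) rfl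
    rcases le_total s (γ₁.value.countP Option.isSome) with hc | hc
    · obtain ⟨τ', γ', a₁, a₂, a₃, a₄, a₅, a₆, a₇⟩ := ih₁ hτ.1
        (fun _ h => hl (.inr (.inl h))) (hu.inter_left hτ h₂) hc
      exact ⟨τ', γ', a₁, a₂, a₃, a₄, a₅, a₆,
        fun z hz => infix_intercalate_left (a₇ z hz)⟩
    · obtain ⟨τ', γ', a₁, a₂, a₃, a₄, a₅, a₆, a₇⟩ := ih₂ hτ.2.1
        (fun _ h => hl (.inr (.inr h))) (hu.inter_right hτ h₁) (by omega)
      exact ⟨τ', γ', a₁, a₂, a₃, a₄, a₅, a₆,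
        fun z hz => (a₇ z hz).trans (infix_intercalate_right _ hτ.2.2.1
          (by rw [h₁.countP_isNone_value hτ.1]; exact hτ.2.2.2.2.2))⟩

/-- The bounds of `IsUseful.exists_balanced` and the lengths of the words in the rules are
bounded uniformly, as there are finitely many labels. -/
theorem exists_uniform_bound {a b c d : T} (hG : G.language = fourMIX a b c d) :
    ∃ K, (∀ w, Term.word w ∈ G.labels → w.length ≤ K) ∧
      ∀ τ ∈ G.labels, G.IsUseful τ → ∀ γ, G.Expands τ γ →
        (∀ x, some x ∈ γ.value → x ∈ [a, b, c, d]) ∧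
        ∀ x ∈ [a, b, c, d], ∀ y ∈ [a, b, c, d],
          γ.value.count (some x) ≤ γ.value.count (some y) + K := by
  have key : ∀ τ : Term G.NT T, ∃ K, (∀ w, τ = Term.word w → w.length ≤ K) ∧
      (G.IsUseful τ → ∀ γ, G.Expands τ γ →
        (∀ x, some x ∈ γ.value → x ∈ [a, b, c, d]) ∧
        ∀ x ∈ [a, b, c, d], ∀ y ∈ [a, b, c, d],
          γ.value.count (some x) ≤ γ.value.count (some y) + K) := by
    intro τ
    obtain ⟨K₁, h₁⟩ : ∃ K, ∀ w, τ = Term.word w → w.length ≤ K := by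
      cases τ with
      | word w => exact ⟨w.length, fun _ h => by cases h; rfl⟩
      | _ => exact ⟨0, fun _ h => by cases h⟩
    by_cases hu : G.IsUseful τ
    · obtain ⟨K₂, h₂⟩ := hu.exists_balanced hG
      refine ⟨max K₁ K₂, fun w hw => (h₁ w hw).trans (le_max_left _ _), fun _ γ hγ =>
        ⟨(h₂ γ hγ).1, fun x hx y hy => ?_⟩⟩
      have := (h₂ γ hγ).2 x hx y hy
      have := le_max_right K₁ K₂
      omega
    · exact ⟨K₁, h₁, fun h => (hu h).elim⟩
  choose f hf using key
  obtain ⟨K, hK⟩ := (finite_labels (G := G)).image f |>.bddAbove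
  have hK' : ∀ τ ∈ G.labels, f τ ≤ K := fun τ hτ => hK (Set.mem_image_of_mem f hτ)
  refine ⟨K, fun w hw => ((hf _).1 w rfl).trans (hK' _ hw), fun τ hτ hu γ hγ =>
    ⟨((hf τ).2 hu γ hγ).1, fun x hx y hy => ?_⟩⟩
  have := ((hf τ).2 hu γ hγ).2 x hx y hy
  have := hK' τ hτ
  omega

end DCFG

/-! ### The word `b²ᵐ aᵐ c²ᵐ aᵐ d²ᵐ` -/

/-- The word `b²ᵐ aᵐ c²ᵐ aᵐ d²ᵐ`. -/
def blockWord (a b c d : T) (m : ℕ) : List T :=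
  List.replicate (2 * m) b ++ (List.replicate m a ++ (List.replicate (2 * m) c ++
    (List.replicate m a ++ List.replicate (2 * m) d)))

theorem blockWord_mem_fourMIX [DecidableEq T] {a b c d : T} (h : [a, b, c, d].Nodup) (m : ℕ) :
    blockWord a b c d m ∈ fourMIX a b c d := by
  simp only [List.nodup_cons, List.mem_cons, List.not_mem_nil, or_false, not_or] at h
  obtain ⟨⟨hab, hac, had⟩, ⟨hbc, hbd⟩, hcd, -⟩ := h
  refine ⟨fun x hx => ?_, ?_⟩
  · simp only [blockWord, List.mem_append, List.mem_replicate] at hx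
    tauto
  · simp [blockWord, List.count_replicate, hab, hac, had, hbc, hbd, hcd, Ne.symm hab,
      Ne.symm hac, Ne.symm had, Ne.symm hbc, Ne.symm hbd, Ne.symm hcd]
    omega

theorem getElem?_blockWord {a b c d x : T} (h : [a, b, c, d].Nodup) {m i : ℕ}
    (hi : (blockWord a b c d m)[i]? = some x) :
    (x = b → i < 2 * m) ∧ (x = c → 3 * m ≤ i ∧ i < 5 * m) ∧ (x = d → 6 * m ≤ i) := by
  simp only [List.nodup_cons, List.mem_cons, List.not_mem_nil, or_false, not_or] at h
  simp only [blockWord, List.getElem?_append, List.getElem?_replicate, List.length_replicate] at hi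
  split_ifs at hi <;> simp only [Option.some.injEq] at hi <;> subst hi <;>
    refine ⟨fun e => ?_, fun e => ?_, fun e => ?_⟩ <;>
    first
      | omega
      | (exfalso; tauto)

/-- Occurrences of two of the letters `b`, `c`, `d` in `b²ᵐ aᵐ c²ᵐ aᵐ d²ᵐ` are separated by a
block `aᵐ`. -/
theorem not_mem_of_infix_blockWord {a b c d : T} (h : [a, b, c, d].Nodup) {m : ℕ} {z : List T}
    (hz : z <:+: blockWord a b c d m) (hm : z.length ≤ m) :
    (b ∉ z ∧ c ∉ z) ∨ (b ∉ z ∧ d ∉ z) ∨ (c ∉ z ∧ d ∉ z) := by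
  obtain ⟨p, q, hpq⟩ := hz
  have key : ∀ x ∈ z, ∃ i < m, (blockWord a b c d m)[p.length + i]? = some x := by
    intro x hx
    obtain ⟨i, hi, rfl⟩ := List.getElem_of_mem hx
    refine ⟨i, by omega, ?_⟩
    rw [← hpq, List.append_assoc, List.getElem?_append_right (by omega)]
    simp [List.getElem?_append_left hi]
  have hbc : ¬ (b ∈ z ∧ c ∈ z) := by
    rintro ⟨hb, hc⟩
    obtain ⟨i, hi, e⟩ := key b hb
    obtain ⟨j, hj, e'⟩ := key c hc
    have := (getElem?_blockWord h e).1 rfl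
    have := (getElem?_blockWord h e').2.1 rfl
    omega
  have hbd : ¬ (b ∈ z ∧ d ∈ z) := by
    rintro ⟨hb, hc⟩
    obtain ⟨i, hi, e⟩ := key b hb
    obtain ⟨j, hj, e'⟩ := key d hc
    have := (getElem?_blockWord h e).1 rfl
    have := (getElem?_blockWord h e').2.2 rfl
    omega
  have hcd : ¬ (c ∈ z ∧ d ∈ z) := by
    rintro ⟨hb, hc⟩
    obtain ⟨i, hi, e⟩ := key c hb
    obtain ⟨j, hj, e'⟩ := key d hc
    have := (getElem?_blockWord h e).2.1 rfl
    have := (getElem?_blockWord h e').2.2 rfl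
    omega
  tauto

theorem countP_isSome_le [DecidableEq T] {a b c d : T} {y : SepWord T}
    (h : ∀ x, some x ∈ y → x ∈ [a, b, c, d]) :
    y.countP Option.isSome ≤
      y.count (some a) + y.count (some b) + y.count (some c) + y.count (some d) := by
  induction y with
  | nil => simp
  | cons x y ih =>
    have ih := ih fun x hx => h x (List.mem_cons_of_mem _ hx)
    cases x with
    | none => simpa using ih
    | some x =>
      have hx := h x List.mem_cons_self
      simp only [List.mem_cons, List.not_mem_nil, or_false] at hx
      simp only [List.count_cons, List.countP_cons, Option.isSome_some, if_true, beq_iff_eq,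
        Option.some.injEq]
      rcases hx with rfl | rfl | rfl | rfl <;> simp only [if_true] <;> omega

end Displacement

theorem mainTheorem4 {T : Type u} [Finite T] [DecidableEq T] (a b c d : T)
    (hdistinct : [a, b, c, d].Nodup) :
    ¬ ∃ G : Displacement.DCFG.{u, v} 1 T, G.language = Displacement.fourMIX a b c d := by
  open Displacement in
  rintro ⟨G, hG⟩
  obtain ⟨K, hword, hbal⟩ := DCFG.exists_uniform_bound hG
  -- A yield with at least `s` letters is too large to miss one of the four letters,
  -- and longer than every word in a rule.
  obtain ⟨s, hs⟩ : ∃ s, s = 4 * K + 1 := ⟨_, rfl⟩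
  obtain ⟨γ₀, hγ₀, hv⟩ := DCFG.mem_language_iff.1
    (hG ▸ blockWord_mem_fourMIX hdistinct (2 * s) : blockWord a b c d (2 * s) ∈ G.language)
  have hsize : s ≤ γ₀.value.countP Option.isSome := by
    rw [hv, countP_isSome_map_some]
    simp [blockWord]
    omega
  obtain ⟨τ, γ, hγ, hτ, hl, hu, hge, hlt, hfac⟩ := DCFG.exists_intermediate_node
    (by omega : 0 < s) (fun w hw => by have := hword w hw; omega) hγ₀ (G.rk_le _)
    (fun _ h => Or.inl ⟨_, h.symm⟩) DCFG.isUseful_start hsize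
  obtain ⟨hletters, hcount⟩ := hbal τ hl hu γ hγ
  obtain ⟨z₁, z₂, hz₁, hz₂, hcover⟩ := exists_two_factors
    ((hγ.countP_isNone_value hτ).trans_le (hτ.rank_le le_rfl))
  have hfew : ∀ z : List T, z.map some <:+: γ.value →
      (b ∉ z ∧ c ∉ z) ∨ (b ∉ z ∧ d ∉ z) ∨ (c ∉ z ∧ d ∉ z) := by
    intro z hz
    refine not_mem_of_infix_blockWord hdistinct (m := 2 * s) ?_ ?_
    · have h := hfac z hz
      rw [hv] at h
      simpa [List.filterMap_map] using h.filterMap id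
    · have h := hz.sublist.countP_le (p := Option.isSome)
      rw [countP_isSome_map_some] at h
      omega
  have hmiss : ∃ x ∈ [a, b, c, d], some x ∉ γ.value := by
    by_contra! hall
    have hb := hcover b (hall b (by simp))
    have hc := hcover c (hall c (by simp))
    have hd := hcover d (hall d (by simp))
    have h₁ := hfew z₁ hz₁
    have h₂ := hfew z₂ hz₂
    grind
  obtain ⟨x, hx, hx'⟩ := hmiss
  have hx0 := List.count_eq_zero.2 hx'
  have := countP_isSome_le hletters
  have := hcount a (by simp) x hx
  have := hcount b (by simp) x hx
  have := hcount c (by simp) x hx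
  have := hcount d (by simp) x hx
  omega
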